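/- Let $\mathcal T=(\mathcal V,\mathcal E)$ be a finite tree, $\lambda>0$, and $\boldsymbol\alpha=(\alpha_e)_{e\in\mathcal E}$, $\boldsymbol\alpha'=(\alpha'_e)_{e\in\mathcal E}$ with $\alpha_e,\alpha'_e\in[0,1]$. A random vector $\boldsymbol N=(N_v)_{v\in\mathcal V}$ with values in $\mathbb N^{\mathcal V}$ is said to follow $\mathrm{MPMRF}(\lambda,\boldsymbol\alpha,\mathcal T)$ if, for some choice of a root $r\in\mathcal V$, it has the joint distribution of the vector defined recursively by $$N_r=L_r,\qquad N_v=\sum_{i=1}^{N_{\mathrm{pa}(v)}} I^{(v)}_i+L_v\quad (v\ne r),$$ where $\mathrm{pa}(v)$ is the parent of $v$ in the tree rooted at $r$, $L_r\sim\mathrm{Poisson}(\lambda)$, $L_v\sim\mathrm{Poisson}(\lambda(1-\alpha_{(\mathrm{pa}(v),v)}))$ for $v\neq r$, $I^{(v)}_i\sim\mathrm{Bernoulli}(\alpha_{(\mathrm{pa}(v),v)})$ for $v\ne r$ and $i\ge1$, and all the variables $L_v$, $I^{(v)}_i$ are independent. Let $\boldsymbol N\sim\mathrm{MPMRF}(\lambda,\boldsymbol\alpha,\mathcal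 T)$ and $\boldsymbol N'\sim\mathrm{MPMRF}(\lambda,\boldsymbol\alpha',\mathcal T)$. If $\alpha_e\le\alpha'_e$ for every $e\in\mathcal E$, then $\boldsymbol N\preceq_{sm}\boldsymbol N'$ in the supermodular order; that is, $\mathrm E[\varphi(\boldsymbol N)]\le \mathrm E[\varphi(\boldsymbol N')]$ for every function $\varphi:\mathbb R^{\mathcal V}\to\mathbb R$ satisfying $\varphi(\boldsymbol x)+\varphi(\boldsymbol y)\le\varphi(\boldsymbol x\wedge\boldsymbol y)+\varphi(\boldsymbol x\vee\boldsymbol y)$ for all $\boldsymbol x,\boldsymbol y\in\mathbb R^{\mathcal V}$ (componentwise minimum and maximum) for which both expectations exist, i.e. $\varphi(\boldsymbol N)$ and $\varphi(\boldsymbol N')$ are integrable. -/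

import Mathlib

open MeasureTheory ProbabilityTheory
open scoped NNReal

namespace TreePoisson

universe u v

/-- The binomial thinning `α ∘ X = ∑_{i = 1}^{X} I_i` built from the sequence `B = (I_i)` of Bernoulli
variables (indexed here from `0`, so that the summation is over `i < X`). -/
def thinning {Ω : Type v} (B : ℕ → Ω → ℕ) (X : Ω → ℕ) (ω : Ω) : ℕ :=
  ∑ i ∈ Finset.range (X ω), B i ω

/-- In the tree `T` rooted at `r`, the vertex `a` is the parent of the vertex `b`: it is the
neighbour of `b` that is one step closer to the root, that is, the neighbour of `b` on the path
from `b` to `r`. -/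
def IsParent {V : Type u} (T : SimpleGraph V) (r a b : V) : Prop :=
  T.Adj a b ∧ T.dist r b = T.dist r a + 1

/-- The stochastic representation, on the tree `T` rooted at `r`, of the vector `N`
from innovations `L v` (`v` a vertex) and Bernoulli sequences `B e` (`e` an edge), which all
together form an independent family:
`N_r = L_r` with `L_r ∼ Poisson(lam)`, and `N_b = α_{(a,b)} ∘ N_a + L_b` with
`L_b ∼ Poisson(lam (1 - α_{(a,b)}))` whenever `a` is the parent of `b`. -/
structure IsStochasticRepresentation {V : Type u} {Ω : Type v} [MeasurableSpace Ω]
    (lam : ℝ≥0) (T : SimpleGraph V) (α : T.edgeSet → unitInterval) (r : V) (P : Measure Ω)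
    (L : V → Ω → ℕ) (B : T.edgeSet → ℕ → Ω → ℕ) (N : Ω → V → ℕ) : Prop where
  indep : iIndepFun (Sum.elim L (fun p : T.edgeSet × ℕ => B p.1 p.2)) P
  bernoulli : ∀ e i, HasLaw (B e i) (bernoulliMeasure 1 0 (α e)) P
  poisson_root : HasLaw (L r) (poissonMeasure lam) P
  poisson_child : ∀ a b (h : IsParent T r a b),
    HasLaw (L b) (poissonMeasure (lam * unitInterval.toNNReal (unitInterval.symm (α ⟨s(a, b), h.1⟩)))) P
  root : ∀ ω, N ω r = L r ω
  child : ∀ a b (h : IsParent T r a b) ω,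
    N ω b = thinning (B ⟨s(a, b), h.1⟩) (fun ω' => N ω' a) ω + L b ω

/-- `N ∼ MPMRF(lam, α, T)`: for some choice of the root, the random vector `N` has the joint
distribution of a vector given by the stochastic representation. -/
def IsMPMRF {V : Type u} {Ω : Type v} [MeasurableSpace Ω]
    (lam : ℝ≥0) (T : SimpleGraph V) (α : T.edgeSet → unitInterval) (N : Ω → V → ℕ) (P : Measure Ω) : Prop :=
  ∃ (r : V) (Ω₀ : Type u) (_ : MeasurableSpace Ω₀) (P₀ : Measure Ω₀) (L : V → Ω₀ → ℕ)
    (B : T.edgeSet → ℕ → Ω₀ → ℕ) (N₀ : Ω₀ → V → ℕ),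
    IsProbabilityMeasure P₀ ∧ IsStochasticRepresentation lam T α r P₀ L B N₀ ∧
      IdentDistrib N N₀ P P₀

/-- Supermodular functions on `ℝ^V` (with componentwise minimum `⊓` and maximum `⊔`). -/
def IsSupermodular {V : Type u} (φ : (V → ℝ) → ℝ) : Prop :=
  ∀ x y : V → ℝ, φ x + φ y ≤ φ (x ⊓ y) + φ (x ⊔ y)

/-- The supermodular order between two random vectors, possibly defined on different
probability spaces: `E[φ(X)] ≤ E[φ(X')]` for every supermodular `φ` for which both expectations
exist. -/
def SupermodularLE {V : Type u} {Ω Ω' : Type*} [MeasurableSpace Ω] [MeasurableSpace Ω']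
    (X : Ω → V → ℝ) (P : Measure Ω) (X' : Ω' → V → ℝ) (P' : Measure Ω') : Prop :=
  ∀ φ : (V → ℝ) → ℝ, IsSupermodular φ →
    Integrable (fun ω => φ (X ω)) P → Integrable (fun ω => φ (X' ω)) P' →
      ∫ ω, φ (X ω) ∂P ≤ ∫ ω, φ (X' ω) ∂P'

end TreePoisson

namespace TreePoisson

/-! Both fields are superpositions of independent Poisson shocks. Give each configuration of open
edges its probability `q` when every edge `e` is open independently with probability `α e`. For each
configuration, let each cluster of open edges receive an independent Poisson shock of mean `lam *
q`, added to all vertices of the cluster. The sum over all configurations has the law of the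
recursion: the generating functions agree, by removing leaves one at a time
(`map_build_eq_map_cellSum`).

The two fields use the same configurations of edge states: an edge is open for both, open for `α'`
only, or closed. With the same shock laws, the first field then has finer clusters than the second.

It remains to see that merging clusters increases the supermodular order. For a fixed configuration
the shocks are i.i.d. over the labels, so permuting the labels does not change their law. To merge
labels `a` and `b`, pair each permutation with its composite with the swap of `a` and `b`: the two
merged vectors are the minimum and the maximum of the two unmerged ones. Summing over permutations
(`IsSupermodular.sum_perm_le`) and integrating over the shocks
(`IsSupermodular.integral_cellSum_le`) concludes. -/

/-! ### Supermodular functions and the merging of labels. -/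

/-- The vector whose coordinate `v` is the sum over the cells `c` of the value carried by the label
of `v` in the cell `c`. -/
def cellSum {V W C R : Type*} [Fintype C] [AddCommMonoid R] (f : C → V → W) (D : C → W → R) (v : V) :
    R :=
  ∑ c, D c (f c v)

/-- Equal fibres give a bijection between the two ranges; since `W` is finite, it extends to the
unused labels. -/
lemma exists_perm_comp_eq {V W : Type*} [Finite W] (f f' : V → W)
    (h : ∀ u v, f u = f v ↔ f' u = f' v) : ∃ σ : Equiv.Perm W, ∀ v, f' v = σ (f v) := by
  classical
  have hex (x : Set.range f) : ∃ v, f v = x := x.2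
  let F : {x // x ∈ Set.range f} → {x // x ∈ Set.range f'} :=
    fun x => ⟨f' (hex x).choose, Set.mem_range_self _⟩
  have hF : Function.Bijective F := by
    constructor
    · intro x y hxy
      have h1 := (h _ _).2 (congrArg Subtype.val hxy)
      rw [(hex x).choose_spec, (hex y).choose_spec] at h1
      exact Subtype.ext h1
    · rintro ⟨_, v, rfl⟩
      refine ⟨⟨f v, v, rfl⟩, Subtype.ext ?_⟩
      exact (h _ _).1 (hex ⟨f v, v, rfl⟩).choose_spec
  refine ⟨(Equiv.ofBijective F hF).extendSubtype, fun v => ?_⟩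
  rw [Equiv.extendSubtype_apply_of_mem _ _ (Set.mem_range_self v)]
  exact ((h _ _).1 (hex ⟨f v, v, rfl⟩).choose_spec).symm

lemma cellSum_eq_add {V W C : Type*} [Fintype C] [DecidableEq C] (f : C → V → W)
    (D : C → W → ℝ) (c : C) (v : V) :
    cellSum f D v = D c (f c v) + ∑ c' ∈ Finset.univ.erase c, D c' (f c' v) :=
  (Finset.add_sum_erase _ _ (Finset.mem_univ c)).symm

section Exchange

variable {V W C : Type*} [DecidableEq W] [Fintype C] [DecidableEq C]

/-- Where the label is `a` or `b`, the two unmerged vectors carry the two values of these labels in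
opposite order, while each merged vector carries one of them throughout. Elsewhere all four agree.
-/
lemma IsSupermodular.add_le_of_merge {φ : (V → ℝ) → ℝ} (hφ : IsSupermodular φ) (f : C → V → W)
    (D : C → W → ℝ) (c : C) (a b : W) (g : C → Equiv.Perm W) :
    φ (cellSum f fun c' w => D c' (g c' w)) +
      φ (cellSum f fun c' w => D c' (Function.update g c (g c * Equiv.swap a b) c' w)) ≤
    φ (cellSum (Function.update f c fun x => if f c x = b then a else f c x)
        fun c' w => D c' (g c' w)) +
      φ (cellSum (Function.update f c fun x => if f c x = b then a else f c x)
        fun c' w => D c' (Function.update g c (g c * Equiv.swap a b) c' w)) := by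
  set x := cellSum f fun c' w => D c' (g c' w) with hx
  set x' := cellSum f fun c' w => D c' (Function.update g c (g c * Equiv.swap a b) c' w) with hx'
  set y := cellSum (Function.update f c fun x => if f c x = b then a else f c x)
        fun c' w => D c' (g c' w) with hy
  set y' := cellSum (Function.update f c fun x => if f c x = b then a else f c x)
        fun c' w => D c' (Function.update g c (g c * Equiv.swap a b) c' w) with hy'
  -- The contribution of the other cells, common to the four vectors.
  let z : V → ℝ := fun v => ∑ c' ∈ Finset.univ.erase c, D c' (g c' (f c' v))
  have ex (v : V) : x v = D c (g c (f c v)) + z v := cellSum_eq_add _ _ c v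
  have ex' (v : V) : x' v = D c (g c (Equiv.swap a b (f c v))) + z v := by
    rw [hx', cellSum_eq_add _ _ c v]
    congr 1
    · simp
    · exact Finset.sum_congr rfl fun c' hc' => by simp [Finset.ne_of_mem_erase hc']
  have ey (v : V) : y v = D c (g c (if f c v = b then a else f c v)) + z v := by
    rw [hy, cellSum_eq_add _ _ c v]
    congr 1
    · simp
    · exact Finset.sum_congr rfl fun c' hc' => by simp [Finset.ne_of_mem_erase hc']
  have ey' (v : V) :
      y' v = D c (g c (Equiv.swap a b (if f c v = b then a else f c v))) + z v := by
    rw [hy', cellSum_eq_add _ _ c v]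
    congr 1
    · simp
    · exact Finset.sum_congr rfl fun c' hc' => by simp [Finset.ne_of_mem_erase hc']
  have key (v : V) : (D c (g c a) ≤ D c (g c b) → x v ⊓ x' v = y v ∧ x v ⊔ x' v = y' v) ∧
      (D c (g c b) ≤ D c (g c a) → x v ⊓ x' v = y' v ∧ x v ⊔ x' v = y v) := by
    rw [ex, ex', ey, ey']
    by_cases h1 : f c v = b
    · simp +contextual [h1]
    · by_cases h2 : f c v = a
      · have h3 : a ≠ b := fun h => h1 (h2.trans h)
        simp +contextual [h2, h3]
      · simp [h1, h2, Equiv.swap_apply_of_ne_of_ne]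
  rcases le_total (D c (g c a)) (D c (g c b)) with h | h
  · have h1 : x ⊓ x' = y := funext fun v => ((key v).1 h).1
    have h2 : x ⊔ x' = y' := funext fun v => ((key v).1 h).2
    rw [← h1, ← h2]
    exact hφ x x'
  · have h1 : x ⊓ x' = y' := funext fun v => ((key v).2 h).1
    have h2 : x ⊔ x' = y := funext fun v => ((key v).2 h).2
    rw [← h1, ← h2, add_comm (φ (x ⊔ x'))]
    exact hφ x x'

variable [Fintype W]

/-- Right multiplication by the swap in the cell `c` is an involution of the index set, so summing
the paired inequality counts each side twice. -/
lemma IsSupermodular.sum_perm_le_of_merge {φ : (V → ℝ) → ℝ} (hφ : IsSupermodular φ)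
    (f : C → V → W) (D : C → W → ℝ) (c : C) (a b : W) :
    ∑ g : C → Equiv.Perm W, φ (cellSum f fun c' w => D c' (g c' w)) ≤
      ∑ g : C → Equiv.Perm W,
        φ (cellSum (Function.update f c fun x => if f c x = b then a else f c x)
          fun c' w => D c' (g c' w)) := by
  let ι : (C → Equiv.Perm W) → (C → Equiv.Perm W) :=
    fun g => Function.update g c (g c * Equiv.swap a b)
  have hι : Function.Involutive ι := fun g => by
    simp [ι, mul_assoc]
  have hsum (F : (C → Equiv.Perm W) → ℝ) : ∑ g, F (ι g) = ∑ g, F g :=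
    Equiv.sum_comp hι.toPerm F
  have h := Finset.sum_le_sum fun g (_ : g ∈ Finset.univ) => hφ.add_le_of_merge f D c a b g
  rw [Finset.sum_add_distrib, Finset.sum_add_distrib,
    hsum fun g => φ (cellSum f fun c' w => D c' (g c' w)),
    hsum fun g => φ (cellSum (Function.update f c fun x => if f c x = b then a else f c x)
          fun c' w => D c' (g c' w))] at h
  linarith

/-- Coarsening the labels increases the sum of a supermodular function over all permutations
of the labels, cell by cell. -/
theorem IsSupermodular.sum_perm_le [Finite V] {φ : (V → ℝ) → ℝ} (hφ : IsSupermodular φ)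
    (D : C → W → ℝ) (f f' : C → V → W) (hf : ∀ c u v, f c u = f c v → f' c u = f' c v) :
    ∑ g : C → Equiv.Perm W, φ (cellSum f fun c w => D c (g c w)) ≤
      ∑ g : C → Equiv.Perm W, φ (cellSum f' fun c w => D c (g c w)) := by
  classical
  have := Fintype.ofFinite V
  -- The number of separated pairs, over all cells, drops at each merge.
  induction hn : (Finset.univ.filter fun p : C × V × V => f p.1 p.2.1 ≠ f p.1 p.2.2).card
    using Nat.strong_induction_on generalizing f with
  | _ n ih =>
    by_cases hex : ∃ c u v, f' c u = f' c v ∧ f c u ≠ f c v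
    · obtain ⟨c, u, v, h1, h2⟩ := hex
      set f₁ : C → V → W :=
        Function.update f c fun x => if f c x = f c v then f c u else f c x with hf₁
      refine (hφ.sum_perm_le_of_merge f D c (f c u) (f c v)).trans
        (ih _ ?_ f₁ ?_ rfl)
      · rw [← hn]
        refine Finset.card_lt_card ((Finset.ssubset_iff_of_subset ?_).2 ⟨(c, u, v), ?_, ?_⟩)
        · rintro ⟨c', x, y⟩
          simp only [Finset.mem_filter, Finset.mem_univ, true_and]
          refine mt fun h => ?_
          by_cases hc : c' = c
          · subst hc
            simp [hf₁, h]
          · simp [hf₁, hc, h]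
        · simpa using h2
        · simp [hf₁]
      · intro c' x y
        by_cases hc : c' = c
        · subst hc
          simp only [hf₁, Function.update_self]
          split_ifs with h3 h4 h4
          · exact fun _ => hf _ _ _ (h3.trans h4.symm)
          · exact fun h => (hf _ _ _ h3).trans (h1.symm.trans (hf _ _ _ h))
          · exact fun h => (hf _ _ _ h).trans (h1.trans (hf _ _ _ h4.symm))
          · exact hf _ _ _
        · simpa [hf₁, hc] using hf c' x y
    · push Not at hex
      -- Nothing is left to merge: `f` and `f'` have the same blocks, and the relabelling is
      -- absorbed by the sum over permutations.
      choose σ hσ using fun c => exists_perm_comp_eq (f c) (f' c)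
        fun u v => ⟨hf c u v, hex c u v⟩
      refine le_of_eq ?_
      rw [← Equiv.sum_comp (Equiv.mulRight σ)]
      refine Finset.sum_congr rfl fun g _ => congrArg φ (funext fun v => ?_)
      simp [cellSum, hσ]

end Exchange

/-! ### Rooted trees and clusters of open edges. -/

/-- A rooted tree with vertex set `V`, presented by its parent map, whose edges, each one joining
a vertex different from the root to its parent, are labelled by `E`. -/
structure RootedTree (V E : Type*) where
  root : V
  parent : V → V
  depth : V → ℕ
  edge : ∀ v, v ≠ root → E
  depth_parent_lt : ∀ v, v ≠ root → depth (parent v) < depth v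
  edge_inj : ∀ u hu v hv, edge u hu = edge v hv → u = v

namespace RootedTree

variable {V E K : Type*}

open Classical in
/-- The vertex closest to the root in the cluster of `v`, when the open edges are those in `o`. -/
noncomputable def label (R : RootedTree V E) (o : Set E) (v : V) : V :=
  if h : v = R.root then v
  else if R.edge v h ∈ o then R.label o (R.parent v) else v
termination_by R.depth v
decreasing_by exact R.depth_parent_lt v h

lemma label_root (R : RootedTree V E) (o : Set E) : R.label o R.root = R.root := by
  rw [label]; simp

lemma label_of_mem (R : RootedTree V E) {o : Set E} {v : V} (h : v ≠ R.root)
    (ho : R.edge v h ∈ o) : R.label o v = R.label o (R.parent v) := by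
  rw [label]; simp [h, ho]

lemma label_of_notMem (R : RootedTree V E) {o : Set E} {v : V} (h : v ≠ R.root)
    (ho : R.edge v h ∉ o) : R.label o v = v := by
  rw [label]; simp [h, ho]

/-- Induction from the root to the leaves. -/
lemma induction (R : RootedTree V E) {p : V → Prop} (root : p R.root)
    (child : ∀ v, v ≠ R.root → p (R.parent v) → p v) (v : V) : p v := by
  induction hn : R.depth v using Nat.strong_induction_on generalizing v with
  | _ n ih =>
    by_cases h : v = R.root
    · exact h ▸ root
    · exact child v h (ih _ (hn ▸ R.depth_parent_lt v h) _ rfl)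

/-- A set of vertices is an initial part of the tree if it contains the parents of its elements. -/
def IsInitial (R : RootedTree V E) (A : Set V) : Prop :=
  ∀ v ∈ A, v ≠ R.root → R.parent v ∈ A

lemma IsInitial.label_mem {R : RootedTree V E} {A : Set V} (hA : R.IsInitial A) (o : Set E) {v : V}
    (hv : v ∈ A) : R.label o v ∈ A := by
  revert hv
  refine R.induction (p := fun v => v ∈ A → R.label o v ∈ A) ?_ ?_ v
  · rw [label_root]; exact id
  · intro v h ih hv
    by_cases ho : R.edge v h ∈ o
    · rw [R.label_of_mem h ho]
      exact ih (hA v hv h)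
    · rwa [R.label_of_notMem h ho]

lemma IsInitial.label_congr {R : RootedTree V E} {A : Set V} (hA : R.IsInitial A) {o o' : Set E}
    (hoo' : ∀ v ∈ A, ∀ h, R.edge v h ∈ o ↔ R.edge v h ∈ o') {v : V} (hv : v ∈ A) :
    R.label o v = R.label o' v := by
  revert hv
  refine R.induction (p := fun v => v ∈ A → R.label o v = R.label o' v) ?_ ?_ v
  · simp [label_root]
  · intro v h ih hv
    by_cases ho : R.edge v h ∈ o
    · rw [R.label_of_mem h ho, R.label_of_mem h ((hoo' v hv h).1 ho)]
      exact ih (hA v hv h)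
    · rw [R.label_of_notMem h ho, R.label_of_notMem h (mt (hoo' v hv h).2 ho)]

end RootedTree

/-! ### The exponent of the generating function of the shock model. -/

section Blocks

variable {V W : Type*} [Fintype V] [DecidableEq W]

/-- The product of `s` over the block of the vertices with label `w`. -/
def blockProd (s : V → ℂ) (ℓ : V → W) (w : W) : ℂ := ∏ v, if ℓ v = w then s v else 1

@[simp]
lemma blockProd_one (ℓ : V → W) (w : W) : blockProd 1 ℓ w = 1 := by simp [blockProd]

lemma blockProd_mul_mulSingle [DecidableEq V] (s : V → ℂ) (ℓ : V → W) (v : V) (t : ℂ) (w : W) :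
    blockProd (s * Pi.mulSingle v t) ℓ w = blockProd s ℓ w * if ℓ v = w then t else 1 := by
  have h (u : V) : (if ℓ u = w then (s * Pi.mulSingle v t : V → ℂ) u else 1) =
      (if ℓ u = w then s u else 1) * if u = v then (if ℓ v = w then t else 1) else 1 := by
    by_cases huv : u = v
    · subst huv
      simp only [Pi.mul_apply, Pi.mulSingle_eq_same, if_true]
      split_ifs <;> simp
    · simp [huv]
  simp only [blockProd, h, Finset.prod_mul_distrib, Finset.prod_ite_eq', Finset.mem_univ, if_true]

variable [Fintype W]

/-- The sum over the labels of the block products, each of them diminished by one. -/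
def blockSum (s : V → ℂ) (ℓ : V → W) : ℂ := ∑ w, (blockProd s ℓ w - 1)

@[simp]
lemma blockSum_one (ℓ : V → W) : blockSum 1 ℓ = 0 := by simp [blockSum]

/-- Only the block containing `v` is affected. Labels that are not used contribute zero to the sum.
-/
lemma blockSum_mul_mulSingle [DecidableEq V] (s : V → ℂ) (ℓ : V → W) (v : V) (t : ℂ) :
    blockSum (s * Pi.mulSingle v t) ℓ = blockSum s ℓ + (t - 1) * blockProd s ℓ (ℓ v) := by
  have h (w : W) : blockProd (s * Pi.mulSingle v t) ℓ w - 1 =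
      (blockProd s ℓ w - 1) + if ℓ v = w then (t - 1) * blockProd s ℓ w else 0 := by
    rw [blockProd_mul_mulSingle]
    split_ifs <;> ring
  simp only [blockSum, h, Finset.sum_add_distrib, Finset.sum_ite_eq, Finset.mem_univ, if_true]

end Blocks

section Cells

variable {E K : Type*} [Fintype E]

/-- The product weight of a configuration. -/
def cellWeight (w : E → K → ℝ≥0) (c : E → K) : ℝ≥0 := ∏ e, w e (c e)

lemma sum_cellWeight [Fintype K] [DecidableEq E] (w : E → K → ℝ≥0) (hw : ∀ e, ∑ k, w e k = 1) :
    ∑ c, cellWeight w c = 1 := by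
  simp [cellWeight, ← Fintype.prod_sum, hw]

/-- Cross-multiplied, so that edge states of weight zero are allowed. -/
lemma cellWeight_update_mul [DecidableEq E] (w : E → K → ℝ≥0) (c : E → K) (e : E) (k : K) :
    cellWeight w (Function.update c e k) * w e (c e) = cellWeight w c * w e k := by
  have h : ∀ c' : E → K, cellWeight w c' = w e (c' e) * ∏ e' ∈ Finset.univ.erase e, w e' (c' e') :=
    fun c' => (Finset.mul_prod_erase _ _ (Finset.mem_univ e)).symm
  have h' : ∏ e' ∈ Finset.univ.erase e, w e' (Function.update c e k e') =
      ∏ e' ∈ Finset.univ.erase e, w e' (c e') :=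
    Finset.prod_congr rfl fun e' he' => by simp [Finset.ne_of_mem_erase he']
  rw [h, h c, h', Function.update_self]
  ring

/-- The exchange of the coordinate `e` of a configuration with a further state. -/
def exchangeCoord [DecidableEq E] (e : E) : Equiv.Perm ((E → K) × K) where
  toFun p := (Function.update p.1 e p.2, p.1 e)
  invFun p := (Function.update p.1 e p.2, p.1 e)
  left_inv p := by simp
  right_inv p := by simp

/-- Resampling one coordinate of a random configuration. -/
lemma sum_cellWeight_mul_eq_sum_resample [Fintype K] [DecidableEq E] (w : E → K → ℝ≥0)
    (hw : ∀ e, ∑ k, w e k = 1) (e : E) (F : K → (E → K) → ℂ)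
    (hF : ∀ k c k', F k (Function.update c e k') = F k c) :
    ∑ c, (cellWeight w c : ℂ) * F (c e) c =
      ∑ c, (cellWeight w c : ℂ) * ∑ k, (w e k : ℂ) * F k c := by
  have hwe : ∑ k, (w e k : ℂ) = 1 := by
    simpa using congrArg (fun x : ℝ≥0 => (x : ℂ)) (hw e)
  have h1 (p : (E → K) × K) : (cellWeight w (Function.update p.1 e p.2) : ℂ) * (w e (p.1 e) : ℂ) =
      (cellWeight w p.1 : ℂ) * (w e p.2 : ℂ) := by
    simpa using congrArg (fun x : ℝ≥0 => (x : ℂ)) (cellWeight_update_mul w p.1 e p.2)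
  have h2 : ∑ p : (E → K) × K, (cellWeight w p.1 : ℂ) * (w e p.2 : ℂ) * F (p.1 e) p.1 =
      ∑ p : (E → K) × K, (cellWeight w p.1 : ℂ) * (w e p.2 : ℂ) * F p.2 p.1 := by
    -- Exchanging the state of `e` with an independent copy preserves the product weight.
    rw [← Equiv.sum_comp (exchangeCoord e)]
    refine Finset.sum_congr rfl fun p _ => ?_
    simp only [exchangeCoord, Equiv.coe_fn_mk, Function.update_self, hF, h1]
  rw [Fintype.sum_prod_type, Fintype.sum_prod_type] at h2
  simp only [← Finset.sum_mul, ← Finset.mul_sum, hwe, one_mul, mul_assoc] at h2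
  exact h2

end Cells

namespace RootedTree

variable {V E K : Type*} [Fintype V] [DecidableEq V] [Fintype E] [DecidableEq E] [Fintype K]

/-- The logarithm, at intensity one, of the probability generating function of the
superposition over all configurations `c` of independent Poisson shocks hitting the clusters of
the open edges `{e | c e ∈ O}`. -/
noncomputable def clusterExponent (R : RootedTree V E) (w : E → K → ℝ≥0) (O : Set K) (s : V → ℂ) :
    ℂ :=
  ∑ c, (cellWeight w c : ℂ) * blockSum s (R.label (c ⁻¹' O))

variable (R : RootedTree V E) (w : E → K → ℝ≥0) (O : Set K)

@[simp]
lemma clusterExponent_one : R.clusterExponent w O 1 = 0 := by simp [clusterExponent]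

lemma clusterExponent_mul_mulSingle (s : V → ℂ) (v : V) (t : ℂ) :
    R.clusterExponent w O (s * Pi.mulSingle v t) = R.clusterExponent w O s +
      (t - 1) * ∑ c, (cellWeight w c : ℂ) *
        blockProd s (R.label (c ⁻¹' O)) (R.label (c ⁻¹' O) v) := by
  simp only [clusterExponent, blockSum_mul_mulSingle, mul_add, Finset.sum_add_distrib,
    Finset.mul_sum]
  congr 1
  exact Finset.sum_congr rfl fun c _ => by ring

lemma clusterExponent_mulSingle (hw : ∀ e, ∑ k, w e k = 1) (v : V) (t : ℂ) :
    R.clusterExponent w O (Pi.mulSingle v t) = t - 1 := by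
  have h := R.clusterExponent_mul_mulSingle w O 1 v t
  have hw' : ∑ c, (cellWeight w c : ℂ) = 1 := by
    simpa using congrArg (fun x : ℝ≥0 => (x : ℂ)) (sum_cellWeight w hw)
  simpa [hw'] using h

open Classical in
/-- Adding a leaf to an initial part of the tree. -/
lemma clusterExponent_mul_mulSingle_leaf (hw : ∀ e, ∑ k, w e k = 1) {A : Set V}
    (hA : R.IsInitial A) {s : V → ℂ} (hs : ∀ u ∉ A, s u = 1) {v : V} (hvA : v ∉ A)
    (hv : v ≠ R.root) (hpA : R.parent v ∈ A) {α : ℝ}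
    (hα : ∑ k, (if k ∈ O then (w (R.edge v hv) k : ℝ) else 0) = α) (t : ℂ) :
    R.clusterExponent w O (s * Pi.mulSingle v t) =
      R.clusterExponent w O (s * Pi.mulSingle (R.parent v) (α * t + (1 - α))) +
        (1 - α) * (t - 1) := by
  set e := R.edge v hv with he
  -- Labels in `A` depend only on edges above vertices of `A`, hence not on the state of `e`.
  have hcongr (c : E → K) (k : K) {u : V} (hu : u ∈ A) :
      R.label (Function.update c e k ⁻¹' O) u = R.label (c ⁻¹' O) u := by
    refine hA.label_congr (fun x hx h => ?_) hu
    have hne : R.edge x h ≠ e := fun h' => hvA (R.edge_inj _ _ _ _ h' ▸ hx)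
    simp [hne]
  let p : (E → K) → ℂ := fun c => blockProd s (R.label (c ⁻¹' O)) (R.label (c ⁻¹' O) (R.parent v))
  have hp (c : E → K) (k : K) : p (Function.update c e k) = p c := by
    simp only [p, blockProd, hcongr c k hpA]
    refine Finset.prod_congr rfl fun u _ => ?_
    by_cases hu : u ∈ A
    · rw [hcongr c k hu]
    · simp [hs u hu]
  -- If `e` is open, `v` joins the block of its parent. Otherwise its block avoids `A`, because
  -- labels of vertices of `A` lie in `A`, and `s` equals one outside `A`.
  have hblock (c : E → K) : blockProd s (R.label (c ⁻¹' O)) (R.label (c ⁻¹' O) v) =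
      if c e ∈ O then p c else 1 := by
    split_ifs with ho
    · rw [R.label_of_mem hv (by exact ho)]
    · rw [R.label_of_notMem hv (by exact ho)]
      refine Finset.prod_eq_one fun u _ => ?_
      by_cases hu : u ∈ A
      · rw [if_neg]
        rintro rfl
        exact hvA (hA.label_mem _ hu)
      · simp [hs u hu]
  have hα' : ∑ k, (if k ∈ O then (w e k : ℂ) else 0) = α := by
    rw [← hα, Complex.ofReal_sum]
    exact Finset.sum_congr rfl fun k _ => by split_ifs <;> simp
  have hwe : ∑ k, (w e k : ℂ) = 1 := by
    simpa using congrArg (fun x : ℝ≥0 => (x : ℂ)) (hw e)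
  have hw' : ∑ c, (cellWeight w c : ℂ) = 1 := by
    simpa using congrArg (fun x : ℝ≥0 => (x : ℂ)) (sum_cellWeight w hw)
  have hinner (c : E → K) : ∑ k, (w e k : ℂ) * (if k ∈ O then p c else 1) =
      α * p c + (1 - α) := by
    have h (k : K) : (w e k : ℂ) * (if k ∈ O then p c else 1) =
        (if k ∈ O then (w e k : ℂ) else 0) * (p c - 1) + w e k := by
      split_ifs <;> ring
    simp only [h, Finset.sum_add_distrib, ← Finset.sum_mul, hα', hwe]
    ring
  have hsum : ∑ c, (cellWeight w c : ℂ) * (if c e ∈ O then p c else 1) =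
      α * ∑ c, (cellWeight w c : ℂ) * p c + (1 - α) := by
    rw [sum_cellWeight_mul_eq_sum_resample w hw e (fun k c => if k ∈ O then p c else 1)
      (fun k c k' => by simp only [hp])]
    simp only [hinner, mul_add, Finset.sum_add_distrib, ← Finset.sum_mul, hw', one_mul,
      Finset.mul_sum]
    congr 1
    exact Finset.sum_congr rfl fun c _ => by ring
  rw [clusterExponent_mul_mulSingle, clusterExponent_mul_mulSingle]
  simp only [hblock, hsum]
  simp only [p]
  ring

end RootedTree

/-! ### Probability generating functions. -/

section GeneratingFunctions

lemma integral_pow_poissonMeasure (r : ℝ≥0) (z : ℂ) :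
    ∫ n, z ^ n ∂poissonMeasure r = Complex.exp (r * (z - 1)) := by
  rw [integral_poissonMeasure]
  calc ∑' n : ℕ, (Real.exp (-r) * (r : ℝ) ^ n / n.factorial) • z ^ n
      = ∑' n : ℕ, (Real.exp (-r) : ℂ) * ((r * z) ^ n / n.factorial) := by
        refine tsum_congr fun n => ?_
        rw [Complex.real_smul, mul_pow]
        push_cast
        ring
    _ = (Real.exp (-r) : ℂ) * Complex.exp (r * z) := by
        rw [tsum_mul_left, (NormedSpace.expSeries_div_hasSum_exp (r * z : ℂ)).tsum_eq,
          Complex.exp_eq_exp_ℂ]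
    _ = Complex.exp (r * (z - 1)) := by
        rw [Complex.ofReal_exp, ← Complex.exp_add]
        push_cast
        ring_nf

lemma integral_pow_bernoulliMeasure (p : unitInterval) (z : ℂ) :
    ∫ n, z ^ n ∂bernoulliMeasure 1 0 p = p * z + (1 - p) := by
  rw [integral_bernoulliMeasure]
  simp

/-- The law on `V → ℕ` is determined by its probability generating function on the torus. -/
theorem ext_of_integral_prod_pow {V : Type*} [Fintype V] {μ ν : Measure (V → ℕ)}
    [IsFiniteMeasure μ] [IsFiniteMeasure ν]
    (h : ∀ s : V → ℂ, (∀ v, ‖s v‖ = 1) → ∫ n, ∏ v, s v ^ n v ∂μ = ∫ n, ∏ v, s v ^ n v ∂ν) :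
    μ = ν := by
  let ι : (V → ℕ) → EuclideanSpace ℝ V := fun n => WithLp.toLp 2 fun v => (n v : ℝ)
  have hι : Measurable ι := .of_discrete
  have hinj : Function.Injective ι := fun n m hnm => by
    ext v
    have := congrArg (fun x : EuclideanSpace ℝ V => x v) hnm
    simpa [ι] using this
  have hemb : MeasurableEmbedding ι := hι.measurableEmbedding hinj
  -- At the points `exp (i t v)` of the torus, the generating function is the characteristic
  -- function.
  have hchar : ∀ μ : Measure (V → ℕ), ∀ t : EuclideanSpace ℝ V,
      charFun (μ.map ι) t = ∫ n, ∏ v, Complex.exp (t v * Complex.I) ^ n v ∂μ := fun μ t => by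
    rw [charFun_apply, hemb.integral_map]
    congr with n
    simp only [← Complex.exp_nat_mul, ← Complex.exp_sum, PiLp.inner_apply]
    congr 1
    simp only [ι, Complex.ofReal_sum, Finset.sum_mul]
    refine Finset.sum_congr rfl fun v _ => ?_
    simp
    ring
  have hmap : μ.map ι = ν.map ι := by
    refine Measure.ext_of_charFun (funext fun t => ?_)
    rw [hchar, hchar]
    exact h _ fun v => Complex.norm_exp_ofReal_mul_I _
  rw [← hemb.comap_map μ, hmap, hemb.comap_map]

/-- The generating function of a superposition of independent Poisson shocks. -/
theorem integral_prod_pow_cellSum {V W C : Type*} [Fintype V] [Fintype W] [DecidableEq W]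
    [Fintype C] (rate : C → ℝ≥0) (f : C → V → W) (s : V → ℂ) :
    ∫ D : C × W → ℕ, ∏ v, s v ^ cellSum f (Function.curry D) v
        ∂Measure.pi (fun p => poissonMeasure (rate p.1)) =
      Complex.exp (∑ c, rate c * blockSum s (f c)) := by
  have h (D : C × W → ℕ) : ∏ v, s v ^ cellSum f (Function.curry D) v =
      ∏ p : C × W, blockProd s (f p.1) p.2 ^ D p := by
    simp only [cellSum, ← Finset.prod_pow_eq_pow_sum, Function.curry]
    rw [Finset.prod_comm, Fintype.prod_prod_type]
    refine Finset.prod_congr rfl fun c _ => ?_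
    simp only [blockProd, ← Finset.prod_pow]
    rw [Finset.prod_comm]
    refine Finset.prod_congr rfl fun v _ => ?_
    simp [ite_pow]
  simp only [h]
  rw [integral_fintype_prod_eq_prod (E := fun _ : C × W => ℕ)
    (fun p n => blockProd s (f p.1) p.2 ^ n)]
  simp only [integral_pow_poissonMeasure, ← Complex.exp_sum, Fintype.sum_prod_type, blockSum,
    Finset.mul_sum]

end GeneratingFunctions

lemma measurable_thinning {Ω : Type*} [MeasurableSpace Ω] {B : ℕ → Ω → ℕ} {X : Ω → ℕ}
    (hB : ∀ i, Measurable (B i)) (hX : Measurable X) : Measurable (thinning B X) := by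
  have h : Measurable fun p : ℕ × Ω => ∑ i ∈ Finset.range p.1, B i p.2 :=
    measurable_from_prod_countable_right fun n =>
      Finset.measurable_fun_sum (Finset.range n) fun i _ => by fun_prop
  exact h.comp (hX.prodMk measurable_id)

/-- Integration of the generating function of a thinned variable conditionally on the past. -/
lemma integral_mul_pow_thinning_add {Ω I : Type*} [MeasurableSpace Ω] {P : Measure Ω}
    [IsProbabilityMeasure P] {Y : Ω → I → ℕ} (hY : Measurable Y) {B : ℕ → Ω → ℕ}
    (hB : ∀ i, Measurable (B i)) {L : Ω → ℕ} (hL : Measurable L)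
    (hind : IndepFun Y (fun ω => ((fun i => B i ω), L ω)) P)
    {G : (I → ℕ) → ℂ} (hG : Measurable G) (hG1 : ∀ y, ‖G y‖ ≤ 1) (a : I) {t : ℂ} (ht : ‖t‖ ≤ 1)
    {z u : ℂ}
    (hz : ∀ n, ∫ ω, t ^ (∑ i ∈ Finset.range n, B i ω + L ω) ∂P = z ^ n * u) :
    ∫ ω, G (Y ω) * t ^ (thinning B (fun ω => Y ω a) ω + L ω) ∂P =
      (∫ ω, G (Y ω) * z ^ Y ω a ∂P) * u := by
  let Q : Ω → (ℕ → ℕ) × ℕ := fun ω => ((fun i => B i ω), L ω)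
  have hQ : Measurable Q := by fun_prop
  let H : (I → ℕ) × ((ℕ → ℕ) × ℕ) → ℂ :=
    fun p => G p.1 * t ^ (∑ i ∈ Finset.range (p.1 a), p.2.1 i + p.2.2)
  have hsum : Measurable fun p : ℕ × (ℕ → ℕ) => ∑ i ∈ Finset.range p.1, p.2 i :=
    measurable_from_prod_countable_right fun n =>
      Finset.measurable_fun_sum (Finset.range n) fun i _ => by fun_prop
  have hpow : Measurable fun n : ℕ => t ^ n := .of_discrete
  have hexp : Measurable fun p : (I → ℕ) × ((ℕ → ℕ) × ℕ) =>
      ∑ i ∈ Finset.range (p.1 a), p.2.1 i + p.2.2 :=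
    (hsum.comp (f := fun p : (I → ℕ) × ((ℕ → ℕ) × ℕ) => (p.1 a, p.2.1)) (by fun_prop)).add
      (by fun_prop)
  have hH : Measurable H := (hG.comp measurable_fst).mul (hpow.comp hexp)
  have hH1 (p) : ‖H p‖ ≤ 1 := by
    simp only [H, norm_mul, norm_pow]
    exact mul_le_one₀ (hG1 _) (by positivity) (pow_le_one₀ (norm_nonneg _) ht)
  have : IsProbabilityMeasure (P.map Y) := Measure.isProbabilityMeasure_map hY.aemeasurable
  have : IsProbabilityMeasure (P.map Q) := Measure.isProbabilityMeasure_map hQ.aemeasurable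
  have hint : Integrable H ((P.map Y).prod (P.map Q)) :=
    (integrable_const (1 : ℝ)).mono' hH.aestronglyMeasurable (Filter.Eventually.of_forall hH1)
  have hmap := (indepFun_iff_map_prod_eq_prod_map_map hY.aemeasurable hQ.aemeasurable).1 hind
  have hzpow : Measurable fun n : ℕ => z ^ n := .of_discrete
  have hinner (y : I → ℕ) : ∫ q, H (y, q) ∂P.map Q = G y * z ^ y a * u := by
    have hHy : Measurable fun q => H (y, q) := hH.comp (by fun_prop)
    rw [integral_map hQ.aemeasurable hHy.aestronglyMeasurable]
    simp only [H, Q]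
    rw [integral_const_mul, hz, mul_assoc]
  calc ∫ ω, G (Y ω) * t ^ (thinning B (fun ω => Y ω a) ω + L ω) ∂P
      = ∫ ω, H (Y ω, Q ω) ∂P := rfl
    _ = ∫ p, H p ∂(P.map Y).prod (P.map Q) := by
        rw [← hmap, integral_map (hY.prodMk hQ).aemeasurable hH.aestronglyMeasurable]
    _ = ∫ y, G y * z ^ y a * u ∂P.map Y := by
        rw [integral_prod _ hint]
        simp only [hinner]
    _ = ∫ ω, G (Y ω) * z ^ Y ω a * u ∂P :=
        integral_map hY.aemeasurable
          ((hG.mul (hzpow.comp (measurable_pi_apply a))).mul_const u).aestronglyMeasurable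
    _ = (∫ ω, G (Y ω) * z ^ Y ω a ∂P) * u := integral_mul_const _ _

/-! ### The recursion on a rooted tree and its law. -/

namespace RootedTree

variable {V E : Type*}

open Classical in
/-- The solution of the recursion `N_root = L_root`, `N_v = ∑_{i < N_{parent v}} B i + L_v`. -/
noncomputable def build (R : RootedTree V E) (L : V → ℕ) (B : E → ℕ → ℕ) (v : V) : ℕ :=
  if h : v = R.root then L v
  else ∑ i ∈ Finset.range (R.build L B (R.parent v)), B (R.edge v h) i + L v
termination_by R.depth v
decreasing_by exact R.depth_parent_lt v h

lemma build_root (R : RootedTree V E) (L : V → ℕ) (B : E → ℕ → ℕ) :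
    R.build L B R.root = L R.root := by
  rw [build]; simp

lemma build_of_ne (R : RootedTree V E) (L : V → ℕ) (B : E → ℕ → ℕ) {v : V} (h : v ≠ R.root) :
    R.build L B v =
      ∑ i ∈ Finset.range (R.build L B (R.parent v)), B (R.edge v h) i + L v := by
  rw [build]; simp [h]

lemma IsInitial.measurable_build {R : RootedTree V E} {A : Set V} (hA : R.IsInitial A) {Ω : Type*}
    [MeasurableSpace Ω] {L : V → Ω → ℕ} {B : E → ℕ → Ω → ℕ} (hL : ∀ v ∈ A, Measurable (L v))
    (hB : ∀ v ∈ A, ∀ h i, Measurable (B (R.edge v h) i)) {v : V} (hv : v ∈ A) :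
    Measurable fun ω => R.build (fun v => L v ω) (fun e i => B e i ω) v := by
  revert hv
  refine R.induction (p := fun v => v ∈ A →
    Measurable fun ω => R.build (fun v => L v ω) (fun e i => B e i ω) v) ?_ ?_ v
  · intro hv
    simpa only [build_root] using hL _ hv
  · intro v h ih hv
    simp only [R.build_of_ne _ _ h]
    exact (measurable_thinning (hB v hv h) (ih (hA v hv h))).add (hL v hv)

variable {R : RootedTree V E}

lemma IsInitial.root_mem {A : Set V} (hA : R.IsInitial A) (hne : A.Nonempty) : R.root ∈ A := by
  obtain ⟨v, hv⟩ := hne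
  revert hv
  exact R.induction (p := fun v => v ∈ A → R.root ∈ A) id (fun v h ih hv => ih (hA v hv h)) v

/-- The variables attached to an initial part are independent of the variables attached to
a vertex outside of it. -/
lemma IsInitial.indepFun_build {A : Set V} (hA : R.IsInitial A) {Ω : Type*}
    [MeasurableSpace Ω] {P : Measure Ω} {L : V → Ω → ℕ} {B : E → ℕ → Ω → ℕ}
    (hL : ∀ v, Measurable (L v)) (hB : ∀ e i, Measurable (B e i))
    (hind : iIndepFun (Sum.elim L (fun p : E × ℕ => B p.1 p.2)) P)
    {v : V} (hvA : v ∉ A) (hv : v ≠ R.root) :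
    IndepFun (fun ω (u : A) => R.build (fun v => L v ω) (fun e i => B e i ω) u)
      (fun ω => ((fun i => B (R.edge v hv) i ω), L v ω)) P := by
  let Z : V ⊕ E × ℕ → Ω → ℕ := Sum.elim L (fun p : E × ℕ => B p.1 p.2)
  -- `S` and `S'` index the innovations used by `A` and by `v`; they are disjoint because an edge
  -- determines its lower endpoint.
  let S : Set (V ⊕ E × ℕ) := {x | (∃ u ∈ A, x = .inl u) ∨ ∃ u ∈ A, ∃ h i, x = .inr (R.edge u h, i)}
  let S' : Set (V ⊕ E × ℕ) := {x | x = .inl v ∨ ∃ i, x = .inr (R.edge v hv, i)}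
  let σ : Set (V ⊕ E × ℕ) → MeasurableSpace Ω :=
    fun S => ⨆ x ∈ S, MeasurableSpace.comap (Z x) inferInstance
  have hZσ (S : Set (V ⊕ E × ℕ)) (x) (hx : x ∈ S) : Measurable[σ S] (Z x) :=
    Measurable.of_comap_le (le_iSup₂_of_le x hx le_rfl)
  have hdisj : Disjoint S S' := by
    refine Set.disjoint_left.2 ?_
    rintro x (⟨u, hu, rfl⟩ | ⟨u, hu, h, i, rfl⟩) (h' | ⟨j, h'⟩)
    · cases h'
      exact hvA hu
    · cases h'
    · cases h'
    · have h2 : R.edge u h = R.edge v hv := congrArg Prod.fst (Sum.inr_injective h')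
      exact hvA (R.edge_inj _ _ _ _ h2 ▸ hu)
  have hZ (x) : Measurable (Z x) := by
    rcases x with u | ⟨e, i⟩
    · exact hL u
    · exact hB e i
  have hindep : Indep (σ S) (σ S') P :=
    indep_iSup_of_disjoint (fun x => (hZ x).comap_le) hind.iIndep hdisj
  rw [IndepFun_iff_Indep]
  refine indep_of_indep_of_le_left (indep_of_indep_of_le_right hindep ?_) ?_
  · refine Measurable.comap_le ?_
    refine @Measurable.prodMk _ (σ S') _ _ _ _ (fun ω i => B (R.edge v hv) i ω) (L v) ?_ ?_
    · exact @measurable_pi_lambda _ _ _ (σ S') _ _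
        fun i => hZσ S' (.inr (R.edge v hv, i)) (Or.inr ⟨i, rfl⟩)
    · exact hZσ S' (.inl v) (Or.inl rfl)
  · refine Measurable.comap_le (@measurable_pi_lambda _ _ _ (σ S) _ _ fun u => ?_)
    exact @IsInitial.measurable_build _ _ _ _ hA _ (σ S) L B
      (fun u hu => hZσ S (.inl u) (Or.inl ⟨u, hu, rfl⟩))
      (fun u hu h i => hZσ S (.inr (R.edge u h, i)) (Or.inr ⟨u, hu, h, i, rfl⟩)) _ u.2

/-- The generating function of the sum of a binomial variable and of an independent Poisson
variable. -/
lemma integral_pow_sum_add {Ω : Type*} [MeasurableSpace Ω] {P : Measure Ω} {L : V → Ω → ℕ}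
    {B : E → ℕ → Ω → ℕ} (hL : ∀ v, Measurable (L v)) (hB : ∀ e i, Measurable (B e i))
    (hind : iIndepFun (Sum.elim L (fun p : E × ℕ => B p.1 p.2)) P) {v : V} {e : E}
    {r : ℝ≥0} {p : unitInterval} (hLaw : P.map (L v) = poissonMeasure r)
    (hBlaw : ∀ i, P.map (B e i) = bernoulliMeasure 1 0 p) (t : ℂ) (n : ℕ) :
    ∫ ω, t ^ (∑ i ∈ Finset.range n, B e i ω + L v ω) ∂P =
      (p * t + (1 - p)) ^ n * Complex.exp (r * (t - 1)) := by
  let g : Option (Fin n) → V ⊕ E × ℕ := fun x => x.elim (.inl v) fun i => .inr (e, i)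
  have hg : Function.Injective g := by
    rintro (_ | i) (_ | j) h
    · rfl
    · cases h
    · cases h
    · have h2 : (i : ℕ) = j := congrArg Prod.snd (Sum.inr_injective h)
      exact congrArg some (Fin.ext h2)
  have hpow : Measurable fun n : ℕ => t ^ n := .of_discrete
  have hmeas (x) : Measurable (Sum.elim L (fun p : E × ℕ => B p.1 p.2) x) := by
    rcases x with u | ⟨e, i⟩
    · exact hL u
    · exact hB e i
  have h := (hind.precomp hg).integral_fun_prod_comp (f := fun _ n => t ^ n)
    (fun x => (hmeas _).aemeasurable) (fun x => hpow.aestronglyMeasurable)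
  simp only [Fintype.prod_option, g, Option.elim, Sum.elim_inl, Sum.elim_inr] at h
  have h1 : ∫ ω, t ^ L v ω ∂P = Complex.exp (r * (t - 1)) := by
    rw [← integral_pow_poissonMeasure, ← hLaw,
      integral_map (hL v).aemeasurable hpow.aestronglyMeasurable]
  have h2 (i : ℕ) : ∫ ω, t ^ B e i ω ∂P = p * t + (1 - p) := by
    rw [← integral_pow_bernoulliMeasure, ← hBlaw i,
      integral_map (hB e i).aemeasurable hpow.aestronglyMeasurable]
  simp only [h1, h2, Finset.prod_const, Finset.card_univ, Fintype.card_fin] at h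
  rw [mul_comm, ← h]
  congr with ω
  rw [pow_add, mul_comm, ← Finset.prod_pow_eq_pow_sum, Fin.prod_univ_eq_prod_range
    (fun i => t ^ B e i ω)]

end RootedTree

lemma norm_convexCombo_le_one (p : unitInterval) {t : ℂ} (ht : ‖t‖ ≤ 1) :
    ‖(p * t + (1 - p) : ℂ)‖ ≤ 1 := by
  have h1 : ‖((p : ℝ) : ℂ)‖ = p := by simpa using p.2.1
  have h2 : ‖(1 - (p : ℝ) : ℂ)‖ = 1 - p := by
    rw [← Complex.ofReal_one, ← Complex.ofReal_sub, Complex.norm_real, Real.norm_eq_abs,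
      abs_of_nonneg (sub_nonneg.2 p.2.2)]
  calc ‖(p * t + (1 - p) : ℂ)‖ ≤ ‖(p * t : ℂ)‖ + ‖(1 - p : ℂ)‖ := norm_add_le _ _
    _ = p * ‖t‖ + (1 - p) := by rw [norm_mul, h1, h2]
    _ ≤ 1 := by nlinarith [p.2.1]

namespace RootedTree

variable {V E K : Type*} [Fintype V] [DecidableEq V] [Fintype E] [DecidableEq E] [Fintype K]
  {R : RootedTree V E}

-- Integrating out a deepest vertex `v` of `A` replaces its argument `t` by the factor `α t + (1 -
-- α)` at its parent, times the exponential coming from the innovation. The exponent of the shock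
-- model obeys the same rule, by `clusterExponent_mul_mulSingle_leaf`. Since this factor need not
-- have modulus one, the induction runs over the closed unit disc.
open Classical in
lemma integral_prod_pow_build_of_isInitial (w : E → K → ℝ≥0) (hw : ∀ e, ∑ k, w e k = 1)
    (O : Set K) {α : E → unitInterval}
    (hα : ∀ e, ∑ k, (if k ∈ O then (w e k : ℝ) else 0) = α e) (lam : ℝ≥0) {Ω : Type*}
    [MeasurableSpace Ω] {P : Measure Ω} [IsProbabilityMeasure P] {L : V → Ω → ℕ}
    {B : E → ℕ → Ω → ℕ} (hL : ∀ v, Measurable (L v)) (hB : ∀ e i, Measurable (B e i))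
    (hind : iIndepFun (Sum.elim L (fun p : E × ℕ => B p.1 p.2)) P)
    (hroot : P.map (L R.root) = poissonMeasure lam)
    (hchild : ∀ v h, P.map (L v) = poissonMeasure
      (lam * unitInterval.toNNReal (unitInterval.symm (α (R.edge v h)))))
    (hBlaw : ∀ e i, P.map (B e i) = bernoulliMeasure 1 0 (α e)) (A : Finset V)
    (hA : R.IsInitial A) (s : V → ℂ) (hs : ∀ v, ‖s v‖ ≤ 1) (hs' : ∀ v ∉ A, s v = 1) :
    ∫ ω, ∏ v, s v ^ R.build (fun v => L v ω) (fun e i => B e i ω) v ∂P =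
      Complex.exp (lam * R.clusterExponent w O s) := by
  induction hn : A.card generalizing A s with
  | zero =>
    rw [Finset.card_eq_zero] at hn
    have : s = 1 := funext fun v => hs' v (by simp [hn])
    simp [this]
  | succ n ih =>
    have hne : A.Nonempty := Finset.card_pos.1 (by omega)
    -- A vertex of maximal depth is the parent of no vertex of `A`, so the rest of `A` is still
    -- initial.
    obtain ⟨v, hvA, hmax⟩ := A.exists_max_image R.depth hne
    have hA' : R.IsInitial (A.erase v : Finset V) := fun u hu h => by
      have hu' := Finset.mem_erase.1 hu
      refine Finset.mem_erase.2 ⟨fun h' => ?_, hA u hu'.2 h⟩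
      have h1 := R.depth_parent_lt u h
      have h2 := hmax u hu'.2
      rw [h'] at h1
      omega
    set s₀ : V → ℂ := Function.update s v 1 with hs₀
    have hs_eq : s = s₀ * Pi.mulSingle v (s v) := by
      ext u
      by_cases h : u = v
      · subst h; simp [hs₀]
      · simp [hs₀, h]
    have hs₀' : ∀ u ∉ A.erase v, s₀ u = 1 := fun u hu => by
      by_cases h : u = v
      · subst h; simp [hs₀]
      · simp only [hs₀, Function.update_of_ne h]
        exact hs' u fun h' => hu (Finset.mem_erase.2 ⟨h, h'⟩)
    have hs₀1 (u) : ‖s₀ u‖ ≤ 1 := by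
      by_cases h : u = v
      · subst h; simp [hs₀]
      · simpa [hs₀, h] using hs u
    set t := s v with ht
    have hprod (r : V → ℂ) (x : V) (z : ℂ) (N : V → ℕ) :
        ∏ u, (r * Pi.mulSingle x z : V → ℂ) u ^ N u = (∏ u, r u ^ N u) * z ^ N x := by
      simp only [Pi.mul_apply, mul_pow, Finset.prod_mul_distrib]
      congr 1
      rw [Fintype.prod_eq_single x fun u hu => by simp [hu]]
      simp
    by_cases hv : v = R.root
    · have hempty : A.erase v = ∅ := by
        by_contra h
        have := hA'.root_mem (Finset.nonempty_iff_ne_empty.2 h)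
        simp [hv] at this
      have : s₀ = 1 := funext fun u => hs₀' u (by simp [hempty])
      have hpow : Measurable fun n : ℕ => t ^ n := .of_discrete
      rw [hs_eq]
      simp only [hprod, this]
      rw [one_mul, clusterExponent_mulSingle _ _ _ hw]
      simp only [Pi.one_apply, one_pow, Finset.prod_const_one, one_mul, hv, build_root]
      rw [← integral_pow_poissonMeasure, ← hroot,
        integral_map (hL _).aemeasurable hpow.aestronglyMeasurable]
    · have hpA : R.parent v ∈ A.erase v := by
        refine Finset.mem_erase.2 ⟨fun h => ?_, hA v hvA hv⟩
        have h1 := R.depth_parent_lt v hv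
        rw [h] at h1
        omega
      set e := R.edge v hv with he
      set z : ℂ := α e * t + (1 - α e) with hz
      have hIH := ih (A.erase v) hA' (s₀ * Pi.mulSingle (R.parent v) z)
        (fun u => by
          by_cases h : u = R.parent v
          · subst h
            rw [Pi.mul_apply, Pi.mulSingle_eq_same, norm_mul]
            exact mul_le_one₀ (hs₀1 _) (norm_nonneg _) (norm_convexCombo_le_one _ (hs v))
          · simpa [h] using hs₀1 u)
        (fun u hu => by
          have h : u ≠ R.parent v := fun h => hu (h ▸ hpA)
          simpa [h] using hs₀' u hu)
        (by rw [Finset.card_erase_of_mem hvA, hn]; rfl)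
      have hleaf := R.clusterExponent_mul_mulSingle_leaf w O hw hA' hs₀'
        (fun h => (Finset.mem_erase.1 h).1 rfl) hv hpA (hα e) t
      let A' : Set V := ↑(A.erase v)
      let Y : Ω → A' → ℕ := fun ω u => R.build (fun v => L v ω) (fun e i => B e i ω) u
      let G : (A' → ℕ) → ℂ := fun y => ∏ u : A', s₀ u ^ y u
      have hY : Measurable Y := measurable_pi_lambda _ fun u =>
        hA'.measurable_build (fun v _ => hL v) (fun v _ h i => hB _ i) u.2
      have hG : Measurable G := Finset.measurable_fun_prod _ fun u _ => by
        have hpow : Measurable fun n : ℕ => s₀ u ^ n := .of_discrete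
        exact hpow.comp (measurable_pi_apply u)
      have hG1 (y) : ‖G y‖ ≤ 1 := by
        simp only [G, norm_prod, norm_pow]
        exact Finset.prod_le_one (fun _ _ => by positivity)
          fun u _ => pow_le_one₀ (norm_nonneg _) (hs₀1 _)
      have hGY (ω) : ∏ u, s₀ u ^ R.build (fun v => L v ω) (fun e i => B e i ω) u = G (Y ω) := by
        refine (Fintype.prod_of_injective (fun u : A' => (u : V)) Subtype.val_injective _ _
          (fun u hu => ?_) (fun u => rfl)).symm
        have hu' : u ∉ A.erase v := fun h => hu ⟨⟨u, h⟩, rfl⟩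
        rw [hs₀' u hu', one_pow]
      have hstep := integral_mul_pow_thinning_add hY (hB e) (hL v)
        (hA'.indepFun_build hL hB hind (fun h => (Finset.mem_erase.1 h).1 rfl) hv) hG hG1
        ⟨R.parent v, hpA⟩ (hs v)
        (integral_pow_sum_add hL hB hind (hchild v hv) (hBlaw e) t)
      calc ∫ ω, ∏ v, s v ^ R.build (fun v => L v ω) (fun e i => B e i ω) v ∂P
          = ∫ ω, G (Y ω) * t ^ (thinning (B e) (fun ω => Y ω ⟨R.parent v, hpA⟩) ω + L v ω) ∂P := by
            rw [hs_eq]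
            simp only [hprod, hGY, R.build_of_ne _ _ hv]
            rfl
        _ = _ := hstep
        _ = Complex.exp (lam * R.clusterExponent w O (s₀ * Pi.mulSingle (R.parent v) z)) *
              Complex.exp (((lam * unitInterval.toNNReal (unitInterval.symm (α e)) : ℝ≥0) : ℂ) *
                (t - 1)) := by
            rw [← hIH]
            simp only [hprod, hGY]
            rfl
        _ = Complex.exp (lam * R.clusterExponent w O s) := by
            rw [← Complex.exp_add, hs_eq, hleaf]
            congr 1
            push_cast
            simp only [unitInterval.coe_toNNReal, unitInterval.coe_symm_eq]
            push_cast
            ring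

open Classical in
/-- The vector of the recursion has the law of the superposition of independent Poisson shocks
hitting the clusters of the random configurations. -/
theorem map_build_eq_map_cellSum (w : E → K → ℝ≥0) (hw : ∀ e, ∑ k, w e k = 1)
    (O : Set K) {α : E → unitInterval}
    (hα : ∀ e, ∑ k, (if k ∈ O then (w e k : ℝ) else 0) = α e) (lam : ℝ≥0) {Ω : Type*}
    [MeasurableSpace Ω] {P : Measure Ω} [IsProbabilityMeasure P] {L : V → Ω → ℕ}
    {B : E → ℕ → Ω → ℕ} (hL : ∀ v, AEMeasurable (L v) P) (hB : ∀ e i, AEMeasurable (B e i) P)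
    (hind : iIndepFun (Sum.elim L (fun p : E × ℕ => B p.1 p.2)) P)
    (hroot : P.map (L R.root) = poissonMeasure lam)
    (hchild : ∀ v h, P.map (L v) = poissonMeasure
      (lam * unitInterval.toNNReal (unitInterval.symm (α (R.edge v h)))))
    (hBlaw : ∀ e i, P.map (B e i) = bernoulliMeasure 1 0 (α e)) :
    P.map (fun ω => R.build (fun v => L v ω) (fun e i => B e i ω)) =
      (Measure.pi fun p : (E → K) × V => poissonMeasure (lam * cellWeight w p.1)).map
        fun D => cellSum (fun c => R.label (c ⁻¹' O)) (Function.curry D) := by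
  -- The laws give only a.e. measurability, so everything passes to measurable versions.
  let L' : V → Ω → ℕ := fun v => (hL v).mk
  let B' : E → ℕ → Ω → ℕ := fun e i => (hB e i).mk
  have hLL' (v) : L v =ᵐ[P] L' v := (hL v).ae_eq_mk
  have hBB' (e i) : B e i =ᵐ[P] B' e i := (hB e i).ae_eq_mk
  have hL' (v) : Measurable (L' v) := (hL v).measurable_mk
  have hB' (e i) : Measurable (B' e i) := (hB e i).measurable_mk
  have hind' : iIndepFun (Sum.elim L' (fun p : E × ℕ => B' p.1 p.2)) P := by
    refine hind.congr fun x => ?_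
    rcases x with v | ⟨e, i⟩
    · exact hLL' v
    · exact hBB' e i
  have hae : (fun ω => R.build (fun v => L v ω) (fun e i => B e i ω)) =ᵐ[P]
      fun ω => R.build (fun v => L' v ω) (fun e i => B' e i ω) := by
    filter_upwards [ae_all_iff.2 hLL', ae_all_iff.2 fun e => ae_all_iff.2 (hBB' e)] with ω h1 h2
    simp only [h1, h2]
  have hmeas : Measurable fun ω => R.build (fun v => L' v ω) (fun e i => B' e i ω) :=
    measurable_pi_lambda _ fun v => IsInitial.measurable_build (A := Set.univ)
      (fun _ _ _ => Set.mem_univ _) (fun v _ => hL' v) (fun v _ h i => hB' _ i) (Set.mem_univ v)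
  have hcell : Measurable fun D : (E → K) × V → ℕ =>
      cellSum (fun c => R.label (c ⁻¹' O)) (Function.curry D) := by
    refine measurable_pi_lambda _ fun v => ?_
    exact Finset.measurable_fun_sum _ fun c _ => measurable_pi_apply _
  rw [Measure.map_congr hae]
  have := Measure.isProbabilityMeasure_map (μ := P) hmeas.aemeasurable
  have := Measure.isProbabilityMeasure_map
    (μ := Measure.pi fun p : (E → K) × V => poissonMeasure (lam * cellWeight w p.1))
    hcell.aemeasurable
  refine ext_of_integral_prod_pow fun s hs => ?_
  have hsm : Measurable fun n : V → ℕ => ∏ v, s v ^ n v := .of_discrete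
  rw [integral_map hmeas.aemeasurable hsm.aestronglyMeasurable,
    integral_map hcell.aemeasurable hsm.aestronglyMeasurable,
    integral_prod_pow_cellSum (fun c => lam * cellWeight w c),
    integral_prod_pow_build_of_isInitial w hw O hα lam hL' hB' hind'
      (by rw [← Measure.map_congr (hLL' _), hroot])
      (fun v h => by rw [← Measure.map_congr (hLL' _), hchild v h])
      (fun e i => by rw [← Measure.map_congr (hBB' _ _), hBlaw]) Finset.univ
      (fun _ _ _ => Finset.mem_coe.2 (Finset.mem_univ _)) s (fun v => (hs v).le) (by simp)]
  simp only [clusterExponent, Finset.mul_sum]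
  congr 1
  refine Finset.sum_congr rfl fun c _ => ?_
  push_cast
  ring

end RootedTree

/-! ### Rooting a graph-theoretic tree. -/

section Tree

variable {V : Type*} {T : SimpleGraph V}

lemma exists_isParent (hT : T.IsTree) {r v : V} (hv : v ≠ r) : ∃ a, IsParent T r a v := by
  obtain ⟨p, hp⟩ := hT.connected.exists_walk_length_eq_dist r v
  have hnil : ¬ p.Nil := fun h => hv h.eq.symm
  have hadj := p.adj_penultimate hnil
  refine ⟨p.penultimate, hadj, ?_⟩
  have h1 := T.dist_le p.dropLast
  have h2 : p.dropLast.length + 1 = p.length := SimpleGraph.Walk.length_dropLast_add_one hnil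
  rcases hT.dist_eq_dist_add_one_of_adj r hadj with h | h <;> omega

lemma IsParent.ne {r a v : V} (h : IsParent T r a v) : v ≠ r := by
  rintro rfl
  have := h.2
  simp at this

/-- A parent is the penultimate vertex of a path from the root, and in a tree this path is unique.
-/
lemma IsParent.unique (hT : T.IsTree) {r a a' v : V} (h : IsParent T r a v)
    (h' : IsParent T r a' v) : a = a' := by
  have key {x : V} (h : IsParent T r x v) : ∃ p : T.Walk r v, p.IsPath ∧ p.penultimate = x := by
    obtain ⟨p, hp⟩ := hT.connected.exists_walk_length_eq_dist r x
    refine ⟨p.concat h.1, (p.concat h.1).isPath_of_length_eq_dist ?_, by simp⟩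
    rw [SimpleGraph.Walk.length_concat, hp, h.2]
  obtain ⟨p, hp, rfl⟩ := key h
  obtain ⟨q, hq, rfl⟩ := key h'
  rw [(hT.existsUnique_path r v).unique hp hq]

open Classical in
/-- A tree rooted at one of its vertices. -/
noncomputable def RootedTree.ofIsTree (hT : T.IsTree) (r : V) : RootedTree V T.edgeSet where
  root := r
  parent v := if h : v = r then r else (exists_isParent hT h).choose
  depth := T.dist r
  edge v h := ⟨s((exists_isParent hT h).choose, v), (exists_isParent hT h).choose_spec.1⟩
  depth_parent_lt v h := by
    rw [dif_neg h, (exists_isParent hT h).choose_spec.2]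
    exact Nat.lt_succ_self _
  edge_inj u hu v hv h := by
    have h1 := (exists_isParent hT hu).choose_spec.2
    have h2 := (exists_isParent hT hv).choose_spec.2
    rcases Sym2.eq_iff.1 (congrArg Subtype.val h) with h | h
    · exact h.2
    · rw [h.1] at h1
      rw [← h.2] at h2
      omega

namespace RootedTree

variable (hT : T.IsTree) (r : V)

lemma isParent_parent_ofIsTree {v : V} (hv : v ≠ r) :
    IsParent T r ((ofIsTree hT r).parent v) v := by
  simp only [ofIsTree, dif_neg hv]
  exact (exists_isParent hT hv).choose_spec

lemma parent_ofIsTree {a v : V} (h : IsParent T r a v) : (ofIsTree hT r).parent v = a :=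
  (isParent_parent_ofIsTree hT r h.ne).unique hT h

lemma edge_ofIsTree {a v : V} (h : IsParent T r a v) :
    (ofIsTree hT r).edge v h.ne = ⟨s(a, v), h.1⟩ := by
  have : (exists_isParent hT h.ne).choose = a :=
    (exists_isParent hT h.ne).choose_spec.unique hT h
  simp only [ofIsTree, this]

/-- The endpoints of an open edge have the same label. -/
lemma label_eq_of_adj {o : Set T.edgeSet} {x y : V} (h : T.Adj x y) (ho : ⟨s(x, y), h⟩ ∈ o) :
    (ofIsTree hT r).label o x = (ofIsTree hT r).label o y := by
  have key {x y : V} (h : IsParent T r x y) (ho : ⟨s(x, y), h.1⟩ ∈ o) :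
      (ofIsTree hT r).label o x = (ofIsTree hT r).label o y := by
    rw [(ofIsTree hT r).label_of_mem h.ne (by rwa [edge_ofIsTree hT r h]), parent_ofIsTree hT r h]
  rcases hT.dist_eq_dist_add_one_of_adj r h with hd | hd
  · refine (key ⟨h.symm, hd⟩ ?_).symm
    convert ho using 1
    exact Subtype.ext Sym2.eq_swap
  · exact key ⟨h, hd⟩ ho

/-- A function which is constant along the open edges factors through the labels. -/
lemma apply_label {β : Type*} {o : Set T.edgeSet} (g : V → β)
    (hg : ∀ x y, ∀ h : T.Adj x y, ⟨s(x, y), h⟩ ∈ o → g x = g y) (v : V) :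
    g ((ofIsTree hT r).label o v) = g v := by
  refine (ofIsTree hT r).induction (p := fun v => g ((ofIsTree hT r).label o v) = g v) ?_ ?_ v
  · rw [label_root]
  · intro v hv ih
    have hp := isParent_parent_ofIsTree hT r hv
    by_cases ho : (ofIsTree hT r).edge v hv ∈ o
    · rw [(ofIsTree hT r).label_of_mem hv ho, ih]
      exact hg _ _ hp.1 (by rwa [edge_ofIsTree hT r hp] at ho)
    · rw [(ofIsTree hT r).label_of_notMem hv ho]

/-- The two fields may be built from different roots. Labels depend on the root, but the partition
into clusters does not: labels for `o'` are constant along the edges of `o`, so they factor through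
the labels for `o`. -/
lemma label_eq_label_of_subset (r' : V) {o o' : Set T.edgeSet} (hoo' : o ⊆ o') {u v : V}
    (h : (ofIsTree hT r).label o u = (ofIsTree hT r).label o v) :
    (ofIsTree hT r').label o' u = (ofIsTree hT r').label o' v := by
  have hg := apply_label hT r (o := o) (g := (ofIsTree hT r').label o')
    fun x y hxy ho => label_eq_of_adj hT r' hxy (hoo' ho)
  rw [← hg u, h, hg v]

end RootedTree

lemma IsStochasticRepresentation.eq_build (hT : T.IsTree) {Ω : Type*} [MeasurableSpace Ω]
    {lam : ℝ≥0} {α : T.edgeSet → unitInterval} {r : V} {P : Measure Ω} {L : V → Ω → ℕ}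
    {B : T.edgeSet → ℕ → Ω → ℕ} {N : Ω → V → ℕ}
    (h : IsStochasticRepresentation lam T α r P L B N) :
    N = fun ω => (RootedTree.ofIsTree hT r).build (fun v => L v ω) (fun e i => B e i ω) := by
  funext ω v
  refine (RootedTree.ofIsTree hT r).induction (p := fun v => N ω v =
    (RootedTree.ofIsTree hT r).build (fun v => L v ω) (fun e i => B e i ω) v) ?_ ?_ v
  · rw [RootedTree.build_root]
    exact h.root ω
  · intro v hv ih
    have hp := RootedTree.isParent_parent_ofIsTree hT r hv
    rw [RootedTree.build_of_ne _ _ _ hv, ← ih, h.child _ _ hp ω, RootedTree.edge_ofIsTree hT r hp]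
    rfl

open Classical in
/-- The shock representation of a multivariate Poisson Markov random field. -/
theorem IsMPMRF.exists_map_eq [Fintype V] (hT : T.IsTree) {Ω : Type*}
    [MeasurableSpace Ω] {lam : ℝ≥0} {α : T.edgeSet → unitInterval} {N : Ω → V → ℕ} {P : Measure Ω}
    (h : IsMPMRF lam T α N P) {K : Type*} [Fintype K] (w : T.edgeSet → K → ℝ≥0)
    (hw : ∀ e, ∑ k, w e k = 1) (O : Set K)
    (hα : ∀ e, ∑ k, (if k ∈ O then (w e k : ℝ) else 0) = α e) :
    ∃ r, P.map N =
      (Measure.pi fun p : (T.edgeSet → K) × V => poissonMeasure (lam * cellWeight w p.1)).map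
        fun D => cellSum (fun c => (RootedTree.ofIsTree hT r).label (c ⁻¹' O))
          (Function.curry D) := by
  obtain ⟨r, Ω₀, _, P₀, L, B, N₀, hP₀, hrep, hid⟩ := h
  refine ⟨r, ?_⟩
  have hchild (v : V) (hv : v ≠ r) := hrep.poisson_child _ _
    (RootedTree.isParent_parent_ofIsTree hT r hv)
  rw [hid.map_eq, hrep.eq_build hT]
  refine RootedTree.map_build_eq_map_cellSum w hw O hα lam (fun v => ?_)
    (fun e i => (hrep.bernoulli e i).aemeasurable) hrep.indep hrep.poisson_root.map_eq
    (fun v hv => ?_) (fun e i => (hrep.bernoulli e i).map_eq)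
  · by_cases hv : v = r
    · exact hv ▸ hrep.poisson_root.aemeasurable
    · exact (hchild v hv).aemeasurable
  · rw [(hchild v hv).map_eq,
      RootedTree.edge_ofIsTree hT r (RootedTree.isParent_parent_ofIsTree hT r hv)]

end Tree

/-! ### Comparison of the shock models and coupling of the edges. -/

/-- Coarsening the labels of a superposition of exchangeable shocks increases it in
the supermodular order. -/
theorem IsSupermodular.integral_cellSum_le {V W C : Type*} [Finite V] [Fintype W] [Fintype C]
    {φ : (V → ℝ) → ℝ} (hφ : IsSupermodular φ) (ν : C → Measure ℕ) [∀ c, SigmaFinite (ν c)]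
    (f f' : C → V → W) (hf : ∀ c u v, f c u = f c v → f' c u = f' c v)
    (hi : Integrable (fun D : C × W → ℕ => φ fun v => ((cellSum f (Function.curry D) v : ℕ) : ℝ))
      (Measure.pi fun p => ν p.1))
    (hi' : Integrable (fun D : C × W → ℕ => φ fun v => ((cellSum f' (Function.curry D) v : ℕ) : ℝ))
      (Measure.pi fun p => ν p.1)) :
    ∫ D : C × W → ℕ, φ (fun v => ((cellSum f (Function.curry D) v : ℕ) : ℝ))
        ∂(Measure.pi fun p => ν p.1) ≤
      ∫ D : C × W → ℕ, φ (fun v => ((cellSum f' (Function.curry D) v : ℕ) : ℝ))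
        ∂(Measure.pi fun p => ν p.1) := by
  classical
  set π : Measure (C × W → ℕ) := Measure.pi fun p => ν p.1 with hπ
  let σ : (C → Equiv.Perm W) → Equiv.Perm (C × W) := fun g => Equiv.prodShear (Equiv.refl C) g
  let S (g : C → Equiv.Perm W) : (C × W → ℕ) ≃ᵐ (C × W → ℕ) :=
    MeasurableEquiv.piCongrLeft (fun _ => ℕ) (σ g).symm
  -- The law `ν c` does not depend on the label, so permuting labels inside each cell preserves the
  -- product measure.
  have hS (g) : MeasurePreserving (S g) π π :=
    measurePreserving_piCongrLeft (fun p : C × W => ν p.1) (σ g).symm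
  have hSapp (g D) (c : C) (w : W) : S g D (c, w) = D (c, g c w) := by
    have h := Equiv.piCongrLeft_apply_apply (fun _ : C × W => ℕ) (σ g).symm D (c, g c w)
    have h2 : (σ g).symm (c, g c w) = (c, w) := by
      rw [Equiv.symm_apply_eq]; rfl
    rw [h2] at h
    exact h
  have hcast (f : C → V → W) (g D) :
      (fun v => ((cellSum f (Function.curry (S g D)) v : ℕ) : ℝ)) =
      cellSum f fun c w => (D (c, g c w) : ℝ) := by
    funext v
    simp [cellSum, Function.curry, hSapp]
  let X (f : C → V → W) (D : C × W → ℕ) : ℝ :=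
    φ fun v => ((cellSum f (Function.curry D) v : ℕ) : ℝ)
  have hpoint (D) : ∑ g, X f (S g D) ≤ ∑ g, X f' (S g D) := by
    simp only [X, hcast]
    exact hφ.sum_perm_le (fun c w => (D (c, w) : ℝ)) f f' hf
  have hint (f : C → V → W) (h : Integrable (X f) π) (g) : Integrable (fun D => X f (S g D)) π :=
    (hS g).integrable_comp_of_integrable h
  have hsum (f : C → V → W) (h : Integrable (X f) π) : ∫ D, ∑ g, X f (S g D) ∂π =
      Fintype.card (C → Equiv.Perm W) * ∫ D, X f D ∂π := by
    rw [integral_finsetSum _ fun g _ => hint f h g]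
    simp only [(hS _).integral_comp', Finset.sum_const, Finset.card_univ, nsmul_eq_mul]
  have hle := integral_mono (integrable_finsetSum _ fun g _ => hint f hi g)
    (integrable_finsetSum _ fun g _ => hint f' hi' g) hpoint
  rw [hsum f hi, hsum f' hi'] at hle
  exact le_of_mul_le_mul_left hle (by exact_mod_cast Fintype.card_pos)

/-- Two multivariate Poisson Markov random fields are ordered when the clusters of one of them are
contained in the clusters of the other one, for a coupling of the open edges given by independent
states of the edges. -/
theorem IsMPMRF.supermodularLE {V K : Type*} [Finite V] [Fintype K] {T : SimpleGraph V}
    (hT : T.IsTree) {lam : ℝ≥0} {α α' : T.edgeSet → unitInterval} {Ω Ω' : Type*}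
    [MeasurableSpace Ω] [MeasurableSpace Ω'] {P : Measure Ω} {P' : Measure Ω'}
    {N : Ω → V → ℕ} {N' : Ω' → V → ℕ} (hN : IsMPMRF lam T α N P) (hN' : IsMPMRF lam T α' N' P')
    (w : T.edgeSet → K → ℝ≥0) (hw : ∀ e, ∑ k, w e k = 1) {O O' : Set K} (hO : O ⊆ O')
    [DecidablePred (· ∈ O)] [DecidablePred (· ∈ O')]
    (hα : ∀ e, ∑ k, (if k ∈ O then (w e k : ℝ) else 0) = α e)
    (hα' : ∀ e, ∑ k, (if k ∈ O' then (w e k : ℝ) else 0) = α' e) :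
    SupermodularLE (fun ω v => (N ω v : ℝ)) P (fun ω v => (N' ω v : ℝ)) P' := by
  classical
  intro φ hφ hi hi'
  have := Fintype.ofFinite V
  obtain ⟨r, hr⟩ := hN.exists_map_eq hT w hw O fun e => by convert hα e
  obtain ⟨r', hr'⟩ := hN'.exists_map_eq hT w hw O' fun e => by convert hα' e
  have hNm : AEMeasurable N P := by
    obtain ⟨_, _, _, _, _, _, _, _, _, h⟩ := hN
    exact h.aemeasurable_fst
  have hNm' : AEMeasurable N' P' := by
    obtain ⟨_, _, _, _, _, _, _, _, _, h⟩ := hN'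
    exact h.aemeasurable_fst
  let ψ : (V → ℕ) → ℝ := fun n => φ fun v => (n v : ℝ)
  have hψ : Measurable ψ := .of_discrete
  have hcell (f : (T.edgeSet → K) → V → V) : Measurable fun D : (T.edgeSet → K) × V → ℕ =>
      cellSum f (Function.curry D) :=
    measurable_pi_lambda _ fun v => Finset.measurable_fun_sum _ fun c _ => measurable_pi_apply _
  have hi₁ := (integrable_map_measure hψ.aestronglyMeasurable hNm).2 hi
  have hi₁' := (integrable_map_measure hψ.aestronglyMeasurable hNm').2 hi'
  have hint : ∫ ω, φ (fun v => (N ω v : ℝ)) ∂P = ∫ n, ψ n ∂P.map N :=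
    (integral_map hNm hψ.aestronglyMeasurable).symm
  have hint' : ∫ ω, φ (fun v => (N' ω v : ℝ)) ∂P' = ∫ n, ψ n ∂P'.map N' :=
    (integral_map hNm' hψ.aestronglyMeasurable).symm
  rw [hr] at hi₁
  rw [hr'] at hi₁'
  rw [hint, hint', hr, hr', integral_map (hcell _).aemeasurable hψ.aestronglyMeasurable,
    integral_map (hcell _).aemeasurable hψ.aestronglyMeasurable]
  exact hφ.integral_cellSum_le (fun c => poissonMeasure (lam * cellWeight w c)) _ _
    (fun c u v h => RootedTree.label_eq_label_of_subset hT r r' (Set.preimage_mono hO) h)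
    ((integrable_map_measure hψ.aestronglyMeasurable (hcell _).aemeasurable).1 hi₁)
    ((integrable_map_measure hψ.aestronglyMeasurable (hcell _).aemeasurable).1 hi₁')

/-- The weights of the three states of an edge: open for `p` and `q`, open for `q` only, closed. -/
noncomputable def couplingWeight (p q : unitInterval) : Fin 3 → ℝ≥0 :=
  ![unitInterval.toNNReal p, Real.toNNReal (q - p), unitInterval.toNNReal (unitInterval.symm q)]

lemma coe_couplingWeight_one {p q : unitInterval} (h : p ≤ q) :
    (couplingWeight p q 1 : ℝ) = q - p :=
  Real.coe_toNNReal _ (sub_nonneg.2 h)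

@[simp]
lemma coe_couplingWeight_zero (p q : unitInterval) : (couplingWeight p q 0 : ℝ) = p := rfl

@[simp]
lemma coe_couplingWeight_two (p q : unitInterval) : (couplingWeight p q 2 : ℝ) = 1 - q := rfl

end TreePoisson

theorem theorem6 {V : Type*} [Finite V] (T : SimpleGraph V) (hT : T.IsTree)
    (lam : ℝ≥0) (hlam : 0 < lam) (α α' : T.edgeSet → unitInterval) (hα : ∀ e, α e ≤ α' e)
    {Ω Ω' : Type*} [MeasurableSpace Ω] [MeasurableSpace Ω']
    (P : Measure Ω) [IsProbabilityMeasure P] (P' : Measure Ω') [IsProbabilityMeasure P']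
    (N : Ω → V → ℕ) (N' : Ω' → V → ℕ)
    (hN : TreePoisson.IsMPMRF lam T α N P) (hN' : TreePoisson.IsMPMRF lam T α' N' P') :
    TreePoisson.SupermodularLE (fun ω v => (N ω v : ℝ)) P (fun ω v => (N' ω v : ℝ)) P' := by
  refine TreePoisson.IsMPMRF.supermodularLE hT hN hN'
    (fun e => TreePoisson.couplingWeight (α e) (α' e)) (fun e => ?_)
    -- State 0 is open for both fields and state 1 for the second only, with weights `α e` and `α' e
    -- - α e`; the latter is where monotonicity enters.
    (O := {0}) (O' := {0, 1}) (by simp) (fun e => ?_) (fun e => ?_)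
  · apply NNReal.coe_injective
    simp [Fin.sum_univ_three, TreePoisson.coe_couplingWeight_one (hα e)]
  · simp
  · simp [Fin.sum_univ_three, TreePoisson.coe_couplingWeight_one (hα e)]
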